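/- Work in a nonstandard universe, i.e. a star extension of the standard universe that satisfies the transfer principle and is $\aleph_1$-saturated (every sequence of internal sets with the finite intersection property has nonempty intersection). Let $\Omega$ be an internal set. An internal algebra on $\Omega$ is an internal family of internal subsets of $\Omega$ that contains $\Omega$ and is closed under complements in $\Omega$ and under unions of two sets. An internal probability space $(\Omega,\mathcal F,\mu)$ consists of an internal algebra $\mathcal F$ on $\Omega$ and an internal map $\mu:\mathcal F\to{}^*[0,1]$ with $\mu(\emptyset)=0$, $\mu(\Omega)=1$ and $\mu(A\cup B)=\mu(A)+\mu(B)$ for all disjoint $A,B\in\mathcal F$. If $\mathcal A$ is an internal algebra on $\Omega$, an internal almost probability measure on $\mathcal A$ is an internal map $P:\mathcal A\to{}^*[0,1]$ with $P(\emptyset)=0$, $P(\Omega)=1$ and $P(A\cup B)\approx P(A)+P(B)$ for all disjoint $A,B\in\mathcal A$, where $\approx$ means that the difference is infinitesimal; then $(\Omega,\mathcal A,P)$ is called an internal almost probability space. For an internal probability space or internal almost probability space $(\Omega,\mathcal A,P)$, with $\mathsf{st}$ the standard part map, let $L(\mathcal A)$ be the collection of all sets $B\subseteq\Omega$, internal or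 not, such that $$\sup\{\mathsf{st}(P(A)) : A\in\mathcal A,\ A\subseteq B\}=\inf\{\mathsf{st}(P(C)) : C\in\mathcal A,\ B\subseteq C\},$$ and for $B\in L(\mathcal A)$ let $L(P)(B)$ be this common value. Two such spaces $(\Omega,\mathcal A,P)$ and $(\Omega,\mathcal F,\mu)$ are Loeb equivalent if $L(\mathcal A)=L(\mathcal F)$ and $L(P)=L(\mu)$. Theorem 3.5. Let $(\Omega,\mathcal F,\mu)$ be an internal probability space and let $\mathcal G$ be an internal algebra on $\Omega$. Let $\mathcal H$ be the internal algebra on $\Omega$ generated by $\mathcal F\cup\mathcal G$, i.e. the smallest internal algebra on $\Omega$ that contains $\mathcal F\cup\mathcal G$. Then there is an internal almost probability measure $P$ on $\mathcal H$ such that $(\Omega,\mathcal H,P)$ is Loeb equivalent to $(\Omega,\mathcal F,\mu)$ if and only if $\mathcal H\subseteq L(\mathcal F)$. -/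

import Mathlib

universe u v

/-- A star extension of the standard universe `Type u`.  The types in `Type u` play the role of the
standard sets.  Every standard type `α` has a star extension `Star α` (written `*α`), every standard
function `f : α → β` an extension `map f : *α → *β`, every standard subset `A` of `α` an extension
`sub A ⊆ *α`, and `std : α → *α` sends a standard element to its copy.

The laws say that the star map commutes with every step in the construction of a first-order
formula: tuples of variables (`pair`), substitution of terms (`sub_preimage`), conjunction
(`sub_inter`), negation (`sub_compl`), the existential quantifier (`sub_image`, for a projection),
equality (`sub_diag`) and standard parameters (`std_mem_sub`).  This is the transfer principle,
for all standard types at once, hence also for higher-order objects such as elements of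
`*(Set α)` and `*(α → β)`. -/
structure StarExtension where
  Star : Type u → Type v
  std : ∀ {α : Type u}, α → Star α
  map : ∀ {α β : Type u}, (α → β) → Star α → Star β
  sub : ∀ {α : Type u}, Set α → Set (Star α)
  pair : ∀ {α β : Type u}, Star α → Star β → Star (α × β)
  map_id : ∀ {α : Type u} (x : Star α), map id x = x
  map_comp : ∀ {α β γ : Type u} (g : β → γ) (f : α → β) (x : Star α),
    map (g ∘ f) x = map g (map f x)
  map_std : ∀ {α β : Type u} (f : α → β) (a : α), map f (std a) = std (f a)
  map_fst_pair : ∀ {α β : Type u} (x : Star α) (y : Star β), map Prod.fst (pair x y) = x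
  map_snd_pair : ∀ {α β : Type u} (x : Star α) (y : Star β), map Prod.snd (pair x y) = y
  pair_eta : ∀ {α β : Type u} (z : Star (α × β)), pair (map Prod.fst z) (map Prod.snd z) = z
  std_mem_sub : ∀ {α : Type u} (A : Set α) (a : α), std a ∈ sub A ↔ a ∈ A
  sub_inter : ∀ {α : Type u} (A B : Set α), sub (A ∩ B) = sub A ∩ sub B
  sub_compl : ∀ {α : Type u} (A : Set α), sub Aᶜ = (sub A)ᶜ
  sub_preimage : ∀ {α β : Type u} (f : α → β) (B : Set β), sub (f ⁻¹' B) = map f ⁻¹' sub B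
  sub_image : ∀ {α β : Type u} (f : α → β) (A : Set α), sub (f '' A) = map f '' sub A
  sub_diag : ∀ (α : Type u),
    sub {p : α × α | p.1 = p.2} = {z | map Prod.fst z = map Prod.snd z}

namespace StarExtension

variable (N : StarExtension.{u, v}) {α β : Type u}

/-- The internal subset of `*α` given by an element of `*(Set α)`, through the star extension
of the membership relation. -/
def toSet (a : N.Star (Set α)) : Set (N.Star α) :=
  {x | N.pair x a ∈ N.sub {p : α × Set α | p.1 ∈ p.2}}

/-- The value at `x ∈ *α` of the internal function given by an element of `*(α → β)`. -/
def app (f : N.Star (α → β)) (x : N.Star α) : N.Star β :=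
  N.map (fun p : (α → β) × α => p.1 p.2) (N.pair f x)

end StarExtension

/-- A nonstandard universe: a star extension (with its transfer principle) that is
`ℵ₁`-saturated, i.e. every sequence of internal sets with the finite intersection property has
nonempty intersection. -/
structure NonstandardUniverse extends StarExtension.{u, v} where
  saturation : ∀ {α : Type u} (a : ℕ → Star (Set α)),
    (∀ n, (⋂ k ≤ n, toStarExtension.toSet (a k)).Nonempty) →
      (⋂ k, toStarExtension.toSet (a k)).Nonempty

open Filter in
/-- Nonstandard universes exist: the ultrapower along a nonprincipal ultrafilter on `ℕ`. -/
noncomputable def NonstandardUniverse.ultrapower : NonstandardUniverse.{u, u} where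
  Star α := Germ (hyperfilter ℕ : Filter ℕ) α
  std a := (↑a : Germ (hyperfilter ℕ : Filter ℕ) _)
  map f := Germ.map f
  sub A := {x | x.LiftPred (· ∈ A)}
  pair := Germ.map₂ Prod.mk
  map_id x := by rw [Germ.map_id]; rfl
  map_comp g f x := by rw [← Germ.map_map]
  map_std f a := rfl
  map_fst_pair x y := by
    induction x, y using Germ.inductionOn₂ with | _ f g => rfl
  map_snd_pair x y := by
    induction x, y using Germ.inductionOn₂ with | _ f g => rfl
  pair_eta z := by
    induction z using Germ.inductionOn with | _ f => rfl
  std_mem_sub A a := by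
    show (∀ᶠ _ in (hyperfilter ℕ : Filter ℕ), a ∈ A) ↔ _
    simp
  sub_inter A B := by
    ext x
    induction x using Germ.inductionOn with | _ f =>
    exact eventually_and
  sub_compl A := by
    ext x
    induction x using Germ.inductionOn with | _ f =>
    exact Ultrafilter.eventually_not
  sub_preimage f B := by
    ext x
    induction x using Germ.inductionOn with | _ g => rfl
  sub_image f A := by
    ext x
    induction x using Germ.inductionOn with | _ g =>
    constructor
    · intro h
      have h : ∀ᶠ i in (hyperfilter ℕ : Filter ℕ), ∃ a, a ∈ A ∧ f a = g i := h
      have : Nonempty _ := h.exists.elim fun i hi => ⟨hi.choose⟩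
      obtain ⟨k, hk⟩ := h.choice
      refine ⟨((k : ℕ → _) : Germ (hyperfilter ℕ : Filter ℕ) _), hk.mono fun i hi => hi.1, ?_⟩
      exact (Germ.coe_eq (f := fun i => f (k i))).2 (hk.mono fun i hi => hi.2)
    · rintro ⟨y, hy, hyg⟩
      induction y using Germ.inductionOn with | _ k =>
      have h1 : ∀ᶠ i in (hyperfilter ℕ : Filter ℕ), k i ∈ A := hy
      have h2 : ∀ᶠ i in (hyperfilter ℕ : Filter ℕ), f (k i) = g i := Germ.coe_eq.1 hyg
      exact (h1.and h2).mono fun i hi => ⟨k i, hi⟩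
  sub_diag α := by
    ext x
    induction x using Germ.inductionOn with | _ g =>
    exact Germ.coe_eq.symm
  saturation {α} a h := by
    classical
    choose b hb using fun n => Quot.exists_rep (a n)
    have key : ∀ (x : ℕ → α) n, ((x : Germ (hyperfilter ℕ : Filter ℕ) α) ∈
        {y : Germ (hyperfilter ℕ : Filter ℕ) α | (Germ.map₂ Prod.mk y (a n)).LiftPred
          (· ∈ {p : α × Set α | p.1 ∈ p.2})}) ↔
        ∀ᶠ i in (hyperfilter ℕ : Filter ℕ), x i ∈ b n i := by
      intro x n
      rw [← hb n]; rfl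
    have h' : ∀ n, ∀ᶠ i in (hyperfilter ℕ : Filter ℕ), ∃ y, ∀ k ≤ n, y ∈ b k i := by
      intro n
      obtain ⟨y, hy⟩ := h n
      induction y using Germ.inductionOn with | _ y =>
      have : ∀ k ∈ Set.Iic n, ∀ᶠ i in (hyperfilter ℕ : Filter ℕ), y i ∈ b k i := by
        intro k hk
        exact (key y k).1 (Set.mem_iInter₂.1 hy k hk)
      exact ((eventually_all_finite (Set.finite_Iic n)).2 this).mono fun i hi => ⟨y i, hi⟩
    have : Nonempty α := (h' 0).exists.elim fun i hi => ⟨hi.choose⟩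
    have hx : ∀ i, ∃ y, ∀ n ≤ i, (∃ y, ∀ k ≤ n, y ∈ b k i) → y ∈ b n i := by
      intro i
      by_cases h0 : ∃ n ≤ i, ∃ y, ∀ k ≤ n, y ∈ b k i
      · obtain ⟨n0, hn0⟩ := h0
        have hm := Nat.findGreatest_spec (P := fun n => ∃ y, ∀ k ≤ n, y ∈ b k i) hn0.1 hn0.2
        obtain ⟨y, hy⟩ := hm
        exact ⟨y, fun n hn hP => hy n (Nat.le_findGreatest hn hP)⟩
      · exact ⟨Classical.arbitrary α, fun n hn hP => absurd ⟨n, hn, hP⟩ h0⟩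
    choose x hx using hx
    refine ⟨(x : Germ (hyperfilter ℕ : Filter ℕ) α), Set.mem_iInter.2 fun n => (key x n).2 ?_⟩
    have hge : ∀ᶠ i in (hyperfilter ℕ : Filter ℕ), n ≤ i :=
      Nat.hyperfilter_le_atTop (eventually_ge_atTop n)
    filter_upwards [h' n, hge] with i h1 h2
    exact hx i n h2 h1

namespace StarExtension

variable (N : StarExtension.{u, v}) {X : Type u}

/-- The hyperreal line `*ℝ`. -/
abbrev HReal : Type v := N.Star (ULift.{u} ℝ)

/-- The copy in `*ℝ` of a standard real number. -/
def ofReal (r : ℝ) : N.HReal := N.std (ULift.up r)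

/-- The order of `*ℝ`: the star extension of the order of `ℝ`. -/
def le (x y : N.HReal) : Prop :=
  N.pair x y ∈ N.sub {p : ULift.{u} ℝ × ULift.{u} ℝ | p.1.down ≤ p.2.down}

/-- The addition of `*ℝ`: the star extension of the addition of `ℝ`. -/
def add (x y : N.HReal) : N.HReal :=
  N.map (fun p : ULift.{u} ℝ × ULift.{u} ℝ => ULift.up (p.1.down + p.2.down)) (N.pair x y)

/-- `x ≈ y`: the hyperreals `x` and `y` differ by an infinitesimal. -/
def InfClose (x y : N.HReal) : Prop :=
  ∀ ε : ℝ, 0 < ε → N.le x (N.add y (N.ofReal ε)) ∧ N.le y (N.add x (N.ofReal ε))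

/-- The standard part of a finite hyperreal. -/
noncomputable def st (x : N.HReal) : ℝ := sSup {r : ℝ | N.le (N.ofReal r) x}

/-- A family of subsets of `*X` is internal if it is (the family of sets given by) an element
of `*(Set (Set X))`; its members are then internal sets. -/
def IsInternalFamily (F : Set (Set (N.Star X))) : Prop :=
  ∃ a : N.Star (Set (Set X)), F = N.toSet '' N.toSet a

/-- The restriction of `m` to the family `F` of internal sets is an internal map into `*ℝ`.
(An internal map on `F` is the restriction of an internal map on all internal subsets of `*X`;
the values of `m` outside `F` are irrelevant.) -/
def IsInternalMapOn (F : Set (Set (N.Star X))) (m : Set (N.Star X) → N.HReal) : Prop :=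
  ∃ f : N.Star (Set X → ULift.{u} ℝ), ∀ a : N.Star (Set X),
    N.toSet a ∈ F → m (N.toSet a) = N.app f a

/-- `F` is an internal algebra (of internal subsets) on `Ω`.  As `Ω ∈ F`, the set `Ω` is
internal. -/
structure IsInternalAlgebra (Ω : Set (N.Star X)) (F : Set (Set (N.Star X))) : Prop where
  internal : N.IsInternalFamily F
  subset : ∀ A ∈ F, A ⊆ Ω
  space_mem : Ω ∈ F
  diff_mem : ∀ A ∈ F, Ω \ A ∈ F
  union_mem : ∀ A ∈ F, ∀ B ∈ F, A ∪ B ∈ F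

/-- The internal algebra on `Ω` generated by `S`: the smallest internal algebra on `Ω` that
contains `S`. -/
def internalAlgebraGen (Ω : Set (N.Star X)) (S : Set (Set (N.Star X))) :
    Set (Set (N.Star X)) :=
  {A | ∀ K, N.IsInternalAlgebra Ω K → S ⊆ K → A ∈ K}

/-- `(Ω, F, μ)` is an internal (finitely additive) probability space. -/
structure IsInternalProbabilitySpace (Ω : Set (N.Star X)) (F : Set (Set (N.Star X)))
    (μ : Set (N.Star X) → N.HReal) : Prop where
  algebra : N.IsInternalAlgebra Ω F
  internal : N.IsInternalMapOn F μ
  mem_unitInterval : ∀ A ∈ F, N.le (N.ofReal 0) (μ A) ∧ N.le (μ A) (N.ofReal 1)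
  empty : μ ∅ = N.ofReal 0
  space : μ Ω = N.ofReal 1
  additive : ∀ A ∈ F, ∀ B ∈ F, Disjoint A B → μ (A ∪ B) = N.add (μ A) (μ B)

/-- `(Ω, F, P)` is an internal almost probability space: `P` is additive on disjoint sets only up
to an infinitesimal. -/
structure IsInternalAlmostProbabilitySpace (Ω : Set (N.Star X)) (F : Set (Set (N.Star X)))
    (P : Set (N.Star X) → N.HReal) : Prop where
  algebra : N.IsInternalAlgebra Ω F
  internal : N.IsInternalMapOn F P
  mem_unitInterval : ∀ A ∈ F, N.le (N.ofReal 0) (P A) ∧ N.le (P A) (N.ofReal 1)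
  empty : P ∅ = N.ofReal 0
  space : P Ω = N.ofReal 1
  almost_additive : ∀ A ∈ F, ∀ B ∈ F, Disjoint A B →
    N.InfClose (P (A ∪ B)) (N.add (P A) (P B))

/-- `sup {st (m A) : B ⊇ A ∈ F}`. -/
noncomputable def innerLoeb (F : Set (Set (N.Star X))) (m : Set (N.Star X) → N.HReal)
    (B : Set (N.Star X)) : ℝ :=
  sSup ((fun A => N.st (m A)) '' {A | A ∈ F ∧ A ⊆ B})

/-- `inf {st (m C) : B ⊆ C ∈ F}`. -/
noncomputable def outerLoeb (F : Set (Set (N.Star X))) (m : Set (N.Star X) → N.HReal)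
    (B : Set (N.Star X)) : ℝ :=
  sInf ((fun C => N.st (m C)) '' {C | C ∈ F ∧ B ⊆ C})

/-- The domain `L(F)` of the Loeb extension of `(Ω, F, m)`: the (possibly external) sets `B ⊆ Ω`
whose inner and outer approximations agree. -/
def loebSets (Ω : Set (N.Star X)) (F : Set (Set (N.Star X)))
    (m : Set (N.Star X) → N.HReal) : Set (Set (N.Star X)) :=
  {B | B ⊆ Ω ∧ N.innerLoeb F m B = N.outerLoeb F m B}

/-- The Loeb extension `L(m)`; it is used on `L(F)` only. -/
noncomputable def loebMeasure (F : Set (Set (N.Star X))) (m : Set (N.Star X) → N.HReal)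
    (B : Set (N.Star X)) : ℝ :=
  N.innerLoeb F m B

/-- `(Ω, H, P)` is Loeb equivalent to `(Ω, F, μ)`: `L(F) = L(H)` and `L(P) = L(μ)`. -/
def LoebEquivalent (Ω : Set (N.Star X)) (H : Set (Set (N.Star X)))
    (P : Set (N.Star X) → N.HReal) (F : Set (Set (N.Star X)))
    (μ : Set (N.Star X) → N.HReal) : Prop :=
  N.loebSets Ω F μ = N.loebSets Ω H P ∧
    ∀ B ∈ N.loebSets Ω F μ, N.loebMeasure H P B = N.loebMeasure F μ B

end StarExtension

/-! Write `H` for the generated algebra. If a suitable `P` exists, every `A ∈ H` is its own inner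
and outer approximation, so `H ⊆ L(H) = L(F)`.

For the converse, let `P A` be the internal supremum of `μ C` over `C ∈ F` with `C ⊆ A`; this is the
star extension of a standard operation, hence internal (`exists_internal_inner`). Its standard part
is the Loeb inner approximation of `A`. Inner approximations are superadditive and outer ones
subadditive on disjoint sets, so where they agree, in particular on `H`, the inner one is additive
(`IsContent.inner_union_eq`). Thus `P` is additive on `H` up to an infinitesimal.

Passing from `F` to `H` does not change the approximations of any `B ⊆ Ω`: `F ⊆ H`, the standard
parts agree on `F`, and each new value is itself a supremum, and also an infimum, of values on `F`
(`IsContent.inner_extension`, `IsContent.outer_extension`). This gives Loeb equivalence. That `H` is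
internal is shown by transferring the standard operation of generating an algebra
(`isInternalAlgebra_gen`). -/

namespace StarExtension

variable (N : StarExtension.{u, v}) {α β γ : Type u} {X : Type u}

/-! ### Transfer -/

/-- The star extension of the predicate `p` holds at `z`. -/
def Holds (z : N.Star α) (p : α → Prop) : Prop := z ∈ N.sub {a | p a}

variable {N}

theorem holds_and {z : N.Star α} {p q : α → Prop} :
    N.Holds z (fun a => p a ∧ q a) ↔ N.Holds z p ∧ N.Holds z q := by
  have h := N.sub_inter {a | p a} {a | q a}
  exact Set.ext_iff.1 h z

theorem holds_not {z : N.Star α} {p : α → Prop} :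
    N.Holds z (fun a => ¬ p a) ↔ ¬ N.Holds z p := by
  have h := N.sub_compl {a | p a}
  exact Set.ext_iff.1 h z

theorem holds_imp {z : N.Star α} {p q : α → Prop} :
    N.Holds z (fun a => p a → q a) ↔ (N.Holds z p → N.Holds z q) := by
  have h : (fun a => p a → q a) = fun a => ¬ (p a ∧ ¬ q a) := by
    funext a; exact propext (by tauto)
  rw [h, holds_not, holds_and, holds_not]
  tauto

theorem holds_iff {z : N.Star α} {p q : α → Prop} :
    N.Holds z (fun a => p a ↔ q a) ↔ (N.Holds z p ↔ N.Holds z q) := by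
  have h : (fun a => p a ↔ q a) = fun a => (p a → q a) ∧ (q a → p a) := by
    funext a; exact propext iff_iff_implies_and_implies
  rw [h, holds_and, holds_imp, holds_imp]
  tauto

theorem holds_or {z : N.Star α} {p q : α → Prop} :
    N.Holds z (fun a => p a ∨ q a) ↔ (N.Holds z p ∨ N.Holds z q) := by
  have h : (fun a => p a ∨ q a) = fun a => ¬ p a → q a := by
    funext a; exact propext or_iff_not_imp_left
  rw [h, holds_imp, holds_not]
  tauto

/-- Only intersections and complements are at hand, so a valid predicate is replaced by the
contradiction-free form `¬ (p a ∧ ¬ p a)`. -/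
theorem holds_of_forall {p : α → Prop} (h : ∀ a, p a) (z : N.Star α) : N.Holds z p := by
  have h1 : N.Holds z (fun a => ¬ (p a ∧ ¬ p a)) := by
    rw [holds_not, holds_and, holds_not]
    tauto
  have h2 : p = fun a => ¬ (p a ∧ ¬ p a) := by
    funext a; simp [h a]
  rwa [h2]

theorem Holds.mono {z : N.Star α} {p q : α → Prop} (hp : N.Holds z p) (h : ∀ a, p a → q a) :
    N.Holds z q :=
  holds_imp.1 (holds_of_forall h z) hp

theorem holds_map {z : N.Star α} {f : α → β} {p : β → Prop} :
    N.Holds (N.map f z) p ↔ N.Holds z (fun a => p (f a)) :=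
  (Set.ext_iff.1 (N.sub_preimage f {b | p b}) z).symm

/-- An existential is the image under the first projection, so this is `sub_image`; `pair_eta` reads
the witness off the preimage. -/
theorem holds_exists {z : N.Star α} {R : α → β → Prop} :
    N.Holds z (fun a => ∃ b, R a b) ↔
      ∃ y : N.Star β, N.Holds (N.pair z y) (fun q => R q.1 q.2) := by
  have h : {a | ∃ b, R a b} = Prod.fst '' {q : α × β | R q.1 q.2} := by
    ext a; simp
  unfold Holds
  rw [h, N.sub_image]
  constructor
  · rintro ⟨w, hw, rfl⟩
    exact ⟨N.map Prod.snd w, by rwa [N.pair_eta]⟩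
  · rintro ⟨y, hy⟩
    exact ⟨_, hy, N.map_fst_pair z y⟩

theorem holds_forall {z : N.Star α} {R : α → β → Prop} :
    N.Holds z (fun a => ∀ b, R a b) ↔
      ∀ y : N.Star β, N.Holds (N.pair z y) (fun q => R q.1 q.2) := by
  have h : (fun a => ∀ b, R a b) = fun a => ¬ ∃ b, ¬ R a b := by
    funext a; exact propext (by push Not; rfl)
  rw [h, holds_not, holds_exists]
  simp only [holds_not (p := fun q : α × β => R q.1 q.2), not_exists, not_not]

theorem pair_map (f : α → β) (g : α → γ) (z : N.Star α) :
    N.pair (N.map f z) (N.map g z) = N.map (fun a => (f a, g a)) z := by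
  rw [← N.pair_eta (N.map (fun a => (f a, g a)) z), ← N.map_comp, ← N.map_comp]
  rfl

theorem holds_eq {z : N.Star α} {f g : α → β} :
    N.Holds z (fun a => f a = g a) ↔ N.map f z = N.map g z := by
  have h := N.sub_diag β
  have h1 : N.Holds z (fun a => f a = g a) ↔
      N.map (fun a => (f a, g a)) z ∈ N.sub {p : β × β | p.1 = p.2} :=
    (holds_map (f := fun a => (f a, g a)) (p := fun p : β × β => p.1 = p.2)).symm
  rw [h1, h, Set.mem_ofPred_eq, ← N.map_comp, ← N.map_comp]
  rfl

theorem holds_mem {z : N.Star α} {f : α → β} {s : α → Set β} :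
    N.Holds z (fun a => f a ∈ s a) ↔ N.map f z ∈ N.toSet (N.map s z) := by
  change _ ↔ N.pair (N.map f z) (N.map s z) ∈ N.sub {p : β × Set β | p.1 ∈ p.2}
  rw [pair_map]
  exact (holds_map (f := fun a => (f a, s a)) (p := fun p : β × Set β => p.1 ∈ p.2)).symm

theorem holds_le {z : N.Star α} {f g : α → ULift.{u} ℝ} :
    N.Holds z (fun a => (f a).down ≤ (g a).down) ↔ N.le (N.map f z) (N.map g z) := by
  unfold le
  rw [pair_map]
  exact (holds_map (f := fun a => (f a, g a))
    (p := fun p : ULift.{u} ℝ × ULift.{u} ℝ => p.1.down ≤ p.2.down)).symm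

theorem map_app (f : α → β → γ) (g : α → β) (z : N.Star α) :
    N.app (N.map f z) (N.map g z) = N.map (fun a => f a (g a)) z := by
  unfold app
  rw [pair_map, ← N.map_comp]
  rfl

theorem map_add (f g : α → ULift.{u} ℝ) (z : N.Star α) :
    N.add (N.map f z) (N.map g z) =
      N.map (fun a => ULift.up ((f a).down + (g a).down)) z := by
  unfold add
  rw [pair_map, ← N.map_comp]
  rfl

/-- A constant map factors through `PUnit`. The images of `z` and of `std unit` in `*PUnit` coincide
because both come from the one element `pair z (std unit)` by maps into `PUnit`, and such maps are
equal. -/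
theorem map_const (b : β) (z : N.Star α) : N.map (fun _ => b) z = N.std b := by
  have h := N.map_std (fun _ : PUnit.{u + 1} => b) PUnit.unit
  have h2 : N.map (fun _ : α => PUnit.unit.{u + 1}) z = N.std PUnit.unit := by
    rw [← N.map_id (N.std PUnit.unit)]
    have := N.map_fst_pair z (N.std PUnit.unit.{u + 1})
    have h3 := N.map_snd_pair z (N.std PUnit.unit.{u + 1})
    rw [← this, ← N.map_comp]
    conv_rhs => rw [← h3, ← N.map_comp]
    rfl
  rw [← h, ← h2, ← N.map_comp]
  rfl

theorem map_ofReal (r : ℝ) (z : N.Star α) : N.map (fun _ => ULift.up r) z = N.ofReal r :=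
  map_const _ z

theorem map_comp_fst (f : α → γ) (x : N.Star α) (y : N.Star β) :
    N.map (fun q : α × β => f q.1) (N.pair x y) = N.map f x := by
  conv_rhs => rw [← N.map_fst_pair x y, ← N.map_comp]
  rfl

theorem map_comp_snd (f : β → γ) (x : N.Star α) (y : N.Star β) :
    N.map (fun q : α × β => f q.2) (N.pair x y) = N.map f y := by
  conv_rhs => rw [← N.map_snd_pair x y, ← N.map_comp]
  rfl

/-! ### Internal sets -/

theorem subset_iff_holds {a b : N.Star (Set X)} :
    N.toSet a ⊆ N.toSet b ↔ N.Holds (N.pair a b) (fun p => p.1 ⊆ p.2) := by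
  change _ ↔ N.Holds (N.pair a b) (fun p => ∀ x, x ∈ p.1 → x ∈ p.2)
  simp only [holds_forall, holds_imp, holds_mem, map_comp_fst, N.map_fst_pair, N.map_snd_pair]
  rfl

theorem toSet_injective : Function.Injective (N.toSet (α := X)) := by
  intro a b hab
  have h1 := subset_iff_holds.1 hab.subset
  have h2 : N.Holds (N.pair a b) (fun p => p.2 ⊆ p.1) := by
    have h := subset_iff_holds.1 hab.symm.subset
    -- Two predicates can be combined only at the same point, so the swapped pair is rewritten over
    -- `pair a b`.
    have e : N.pair b a = N.map (fun p : Set X × Set X => (p.2, p.1)) (N.pair a b) := by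
      rw [← pair_map, N.map_fst_pair, N.map_snd_pair]
    rw [e] at h
    exact holds_map.1 h
  have h3 : N.Holds (N.pair a b) (fun p => p.1 = p.2) :=
    (holds_and.2 ⟨h1, h2⟩).mono fun p hp => hp.1.antisymm hp.2
  simpa only [holds_eq, N.map_fst_pair, N.map_snd_pair] using h3

theorem map_subset_iff {z : N.Star α} {s t : α → Set X} :
    N.toSet (N.map s z) ⊆ N.toSet (N.map t z) ↔ N.Holds z (fun a => s a ⊆ t a) := by
  rw [subset_iff_holds, pair_map, holds_map]

theorem toSet_map_union (s t : α → Set X) (z : N.Star α) :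
    N.toSet (N.map (fun a => s a ∪ t a) z) = N.toSet (N.map s z) ∪ N.toSet (N.map t z) := by
  ext x
  have h := holds_of_forall (p := fun q : α × X => q.2 ∈ s q.1 ∪ t q.1 ↔ (q.2 ∈ s q.1 ∨ q.2 ∈ t q.1))
    (fun q => Iff.rfl) (N.pair z x)
  simp only [holds_iff, holds_or, holds_mem] at h
  rw [map_comp_fst (fun a => s a ∪ t a), map_comp_fst s, map_comp_fst t, N.map_snd_pair] at h
  exact h

theorem toSet_map_diff (s t : α → Set X) (z : N.Star α) :
    N.toSet (N.map (fun a => s a \ t a) z) = N.toSet (N.map s z) \ N.toSet (N.map t z) := by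
  ext x
  have h := holds_of_forall (p := fun q : α × X => q.2 ∈ s q.1 \ t q.1 ↔ (q.2 ∈ s q.1 ∧ ¬ q.2 ∈ t q.1))
    (fun q => Iff.rfl) (N.pair z x)
  simp only [holds_iff, holds_and, holds_not, holds_mem] at h
  rw [map_comp_fst (fun a => s a \ t a), map_comp_fst s, map_comp_fst t, N.map_snd_pair] at h
  exact h

theorem toSet_mem_image {a : N.Star (Set X)} {k : N.Star (Set (Set X))} :
    N.toSet a ∈ N.toSet '' N.toSet k ↔ a ∈ N.toSet k :=
  toSet_injective.mem_set_image

/-! ### Internal algebras -/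

/-- `K` is an algebra of subsets of `Ω`. -/
structure IsAlgebraOn {Y : Type*} (Ω : Set Y) (K : Set (Set Y)) : Prop where
  subset : ∀ A, A ∈ K → A ⊆ Ω
  space_mem : Ω ∈ K
  diff_mem : ∀ A, A ∈ K → Ω \ A ∈ K
  union_mem : ∀ A, A ∈ K → ∀ B, B ∈ K → A ∪ B ∈ K

theorem IsInternalAlgebra.isAlgebraOn {Ω : Set (N.Star X)} {F : Set (Set (N.Star X))}
    (h : N.IsInternalAlgebra Ω F) : IsAlgebraOn Ω F :=
  ⟨h.subset, h.space_mem, h.diff_mem, h.union_mem⟩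

/-- The closure conditions quantify only over members of the family, all of them internal, so they
are first-order in the codes of the space and of the family. -/
theorem isAlgebraOn_iff_holds {z : N.Star α} {o : α → Set X} {k : α → Set (Set X)} :
    IsAlgebraOn (N.toSet (N.map o z)) (N.toSet '' N.toSet (N.map k z)) ↔
      N.Holds z (fun a => IsAlgebraOn (o a) (k a)) := by
  have e : (fun a => IsAlgebraOn (o a) (k a)) = fun a =>
      (∀ A, A ∈ k a → A ⊆ o a) ∧ o a ∈ k a ∧ (∀ A, A ∈ k a → o a \ A ∈ k a) ∧
        ∀ A, A ∈ k a → ∀ B, B ∈ k a → A ∪ B ∈ k a := by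
    funext a
    exact propext ⟨fun h => ⟨h.1, h.2, h.3, h.4⟩, fun h => ⟨h.1, h.2.1, h.2.2.1, h.2.2.2⟩⟩
  have e1 : N.Holds z (fun a => ∀ A, A ∈ k a → A ⊆ o a) ↔
      ∀ A, A ∈ N.toSet (N.map k z) → N.toSet A ⊆ N.toSet (N.map o z) := by
    rw [holds_forall]
    refine forall_congr' fun A => ?_
    rw [holds_imp, holds_mem, ← map_subset_iff, map_comp_fst k, map_comp_fst o, N.map_snd_pair]
  have e2 : N.Holds z (fun a => ∀ A, A ∈ k a → o a \ A ∈ k a) ↔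
      ∀ A, A ∈ N.toSet (N.map k z) →
        N.toSet (N.map o z) \ N.toSet A ∈ N.toSet '' N.toSet (N.map k z) := by
    rw [holds_forall]
    refine forall_congr' fun A => ?_
    have := toSet_map_diff (N := N) (fun q : α × Set X => o q.1) (fun q => q.2) (N.pair z A)
    rw [map_comp_fst o, N.map_snd_pair] at this
    rw [holds_imp, holds_mem, holds_mem, map_comp_fst k, N.map_snd_pair, ← this, toSet_mem_image]
  have e3 : N.Holds z (fun a => ∀ A, A ∈ k a → ∀ B, B ∈ k a → A ∪ B ∈ k a) ↔
      ∀ A, A ∈ N.toSet (N.map k z) → ∀ B, B ∈ N.toSet (N.map k z) →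
        N.toSet A ∪ N.toSet B ∈ N.toSet '' N.toSet (N.map k z) := by
    rw [holds_forall]
    refine forall_congr' fun A => ?_
    rw [holds_imp, holds_mem, map_comp_fst k, N.map_snd_pair, holds_forall]
    refine imp_congr_right fun _ => forall_congr' fun B => ?_
    have := toSet_map_union (N := N) (fun q : (α × Set X) × Set X => q.1.2) (fun q => q.2)
      (N.pair (N.pair z A) B)
    rw [map_comp_fst Prod.snd, N.map_snd_pair, N.map_snd_pair] at this
    rw [holds_imp, holds_mem, holds_mem, map_comp_fst (fun q : α × Set X => k q.1),
      map_comp_fst k, N.map_snd_pair, ← this, toSet_mem_image]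
  rw [e, holds_and, holds_and, holds_and, e1, e2, e3, holds_mem]
  constructor
  · intro h
    exact ⟨fun A hA => h.1 _ (Set.mem_image_of_mem _ hA), toSet_mem_image.1 h.2,
      fun A hA => h.3 _ (Set.mem_image_of_mem _ hA),
      fun A hA B hB => h.4 _ (Set.mem_image_of_mem _ hA) _ (Set.mem_image_of_mem _ hB)⟩
  · rintro ⟨h1, h2, h3, h4⟩
    refine ⟨?_, toSet_mem_image.2 h2, ?_, ?_⟩
    · rintro _ ⟨A, hA, rfl⟩
      exact h1 A hA
    · rintro _ ⟨A, hA, rfl⟩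
      exact h3 A hA
    · rintro _ ⟨A, hA, rfl⟩ _ ⟨B, hB, rfl⟩
      exact h4 A hA B hB

/-- The algebra on `Ω` generated by `S`. -/
def algebraGen {Y : Type*} (Ω : Set Y) (S : Set (Set Y)) : Set (Set Y) :=
  {A | ∀ K, IsAlgebraOn Ω K → S ⊆ K → A ∈ K}

theorem isAlgebraOn_algebraGen {Y : Type*} {Ω : Set Y} {S : Set (Set Y)}
    (hS : ∀ A ∈ S, A ⊆ Ω) : IsAlgebraOn Ω (algebraGen Ω S) where
  -- The power set of `Ω` is a competing algebra, which bounds every generated set.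
  subset _ hA := hA {A | A ⊆ Ω}
    ⟨fun _ h => h, Set.Subset.rfl, fun _ _ => Set.sdiff_subset, fun _ h _ h' => Set.union_subset h h'⟩
    hS
  space_mem _ hK _ := hK.space_mem
  diff_mem A hA K hK hS := hK.diff_mem A (hA K hK hS)
  union_mem A hA B hB K hK hS := hK.union_mem A (hA K hK hS) B (hB K hK hS)

theorem image_toSet_subset {k l : N.Star (Set (Set X))} :
    N.toSet '' N.toSet k ⊆ N.toSet '' N.toSet l ↔ N.toSet k ⊆ N.toSet l :=
  Set.image_subset_image_iff toSet_injective

/-- The definition intersects an external collection of families, so internality is not evident. The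
candidate is the star extension of `algebraGen` at the codes of `Ω`, `F`, `G`; by transfer it is an
internal algebra containing `F ∪ G` and lies in every other one. -/
theorem isInternalAlgebra_gen {Ω : Set (N.Star X)} {F G : Set (Set (N.Star X))}
    (hF : N.IsInternalAlgebra Ω F) (hG : N.IsInternalAlgebra Ω G) :
    N.IsInternalAlgebra Ω (N.internalAlgebraGen Ω (F ∪ G)) := by
  obtain ⟨φ, hφ⟩ := hF.internal
  obtain ⟨γ, hγ⟩ := hG.internal
  obtain ⟨ω, -, hω⟩ : Ω ∈ N.toSet '' N.toSet φ := hφ ▸ hF.space_mem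
  let W := (Set X × Set (Set X)) × Set (Set X)
  let z : N.Star W := N.pair (N.pair ω φ) γ
  have zω : N.map (fun w : W => w.1.1) z = ω :=
    (map_comp_fst Prod.fst _ _).trans (N.map_fst_pair _ _)
  have zφ : N.map (fun w : W => w.1.2) z = φ :=
    (map_comp_fst Prod.snd _ _).trans (N.map_snd_pair _ _)
  have zγ : N.map (fun w : W => w.2) z = γ := N.map_snd_pair _ _
  let g : W → Set (Set X) := fun w => algebraGen w.1.1 (w.1.2 ∪ w.2)
  have hF' : N.Holds z (fun w => IsAlgebraOn w.1.1 w.1.2) := by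
    rw [← isAlgebraOn_iff_holds, zω, zφ, hω, ← hφ]
    exact hF.isAlgebraOn
  have hG' : N.Holds z (fun w => IsAlgebraOn w.1.1 w.2) := by
    rw [← isAlgebraOn_iff_holds, zω, zγ, hω, ← hγ]
    exact hG.isAlgebraOn
  have halg : IsAlgebraOn Ω (N.toSet '' N.toSet (N.map g z)) := by
    rw [← hω, ← zω, isAlgebraOn_iff_holds]
    refine (holds_and.2 ⟨hF', hG'⟩).mono fun w hw => isAlgebraOn_algebraGen ?_
    rintro A (hA | hA)
    · exact hw.1.subset A hA
    · exact hw.2.subset A hA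
  have hsub : F ∪ G ⊆ N.toSet '' N.toSet (N.map g z) := by
    refine Set.union_subset ?_ ?_
    · rw [hφ, image_toSet_subset, ← zφ, map_subset_iff]
      exact holds_of_forall (fun w A hA K _ hS => hS (Or.inl hA)) z
    · rw [hγ, image_toSet_subset, ← zγ, map_subset_iff]
      exact holds_of_forall (fun w A hA K _ hS => hS (Or.inr hA)) z
  have hint : N.IsInternalAlgebra Ω (N.toSet '' N.toSet (N.map g z)) :=
    ⟨⟨_, rfl⟩, halg.subset, halg.space_mem, halg.diff_mem, halg.union_mem⟩
  have heq : N.internalAlgebraGen Ω (F ∪ G) = N.toSet '' N.toSet (N.map g z) := by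
    refine Set.Subset.antisymm (fun A hA => hA _ hint hsub) ?_
    intro A hA K hK hFG
    obtain ⟨k, hk⟩ := hK.internal
    suffices h : N.toSet '' N.toSet (N.map g z) ⊆ N.toSet '' N.toSet k from hk ▸ h hA
    -- The code of the competitor `K` joins the tuple, so that minimality is transferred at a single
    -- point.
    let y : N.Star (W × Set (Set X)) := N.pair z k
    have yω : N.map (fun w : W × Set (Set X) => w.1.1.1) y = ω :=
      (map_comp_fst (fun w : W => w.1.1) _ _).trans zω
    have yφ : N.map (fun w : W × Set (Set X) => w.1.1.2) y = φ :=
      (map_comp_fst (fun w : W => w.1.2) _ _).trans zφ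
    have yγ : N.map (fun w : W × Set (Set X) => w.1.2) y = γ :=
      (map_comp_fst (fun w : W => w.2) _ _).trans zγ
    have yg : N.map (fun w : W × Set (Set X) => g w.1) y = N.map g z := map_comp_fst g _ _
    have yk : N.map (fun w : W × Set (Set X) => w.2) y = k := N.map_snd_pair _ _
    have h1 : N.Holds y (fun w => IsAlgebraOn w.1.1.1 w.2) := by
      rw [← isAlgebraOn_iff_holds, yω, yk, hω, ← hk]
      exact hK.isAlgebraOn
    have h2 : N.Holds y (fun w => w.1.1.2 ⊆ w.2) := by
      rw [← map_subset_iff, yφ, yk, ← image_toSet_subset, ← hφ, ← hk]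
      exact Set.subset_union_left.trans hFG
    have h3 : N.Holds y (fun w => w.1.2 ⊆ w.2) := by
      rw [← map_subset_iff, yγ, yk, ← image_toSet_subset, ← hγ, ← hk]
      exact Set.subset_union_right.trans hFG
    rw [image_toSet_subset, ← yg, ← yk, map_subset_iff]
    exact (holds_and.2 ⟨h1, holds_and.2 ⟨h2, h3⟩⟩).mono fun w hw B hB =>
      hB _ hw.1 (Set.union_subset hw.2.1 hw.2.2)
  rw [heq]
  exact hint

theorem subset_internalAlgebraGen (Ω : Set (N.Star X)) (S : Set (Set (N.Star X))) :
    S ⊆ N.internalAlgebraGen Ω S :=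
  fun _ hA _ _ hS => hS hA

/-! ### Hyperreals and standard parts -/

theorem le_trans' {x y z : N.HReal} (hxy : N.le x y) (hyz : N.le y z) : N.le x z := by
  -- The pattern for all facts on `*ℝ`: gather the variables in one tuple, write each as a
  -- projection of it, and transfer the real fact.
  let w := N.pair (N.pair x y) z
  let T := (ULift.{u} ℝ × ULift.{u} ℝ) × ULift.{u} ℝ
  have wx : N.map (fun t : T => t.1.1) w = x :=
    (map_comp_fst Prod.fst _ _).trans (N.map_fst_pair _ _)
  have wy : N.map (fun t : T => t.1.2) w = y :=
    (map_comp_fst Prod.snd _ _).trans (N.map_snd_pair _ _)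
  have wz : N.map (fun t : T => t.2) w = z := N.map_snd_pair _ _
  rw [← wx, ← wy, ← holds_le] at hxy
  rw [← wy, ← wz, ← holds_le] at hyz
  rw [← wx, ← wz, ← holds_le]
  exact (holds_and.2 ⟨hxy, hyz⟩).mono fun _ h => h.1.trans h.2

theorem le_antisymm' {x y : N.HReal} (hxy : N.le x y) (hyx : N.le y x) : x = y := by
  have wx : N.map (fun t => t.1) (N.pair x y) = x := N.map_fst_pair _ _
  have wy : N.map (fun t => t.2) (N.pair x y) = y := N.map_snd_pair _ _
  generalize N.pair x y = w at wx wy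
  subst wx wy
  rw [← holds_le] at hxy hyx
  rw [← holds_eq]
  exact (holds_and.2 ⟨hxy, hyx⟩).mono fun _ h => ULift.ext _ _ (le_antisymm h.1 h.2)

theorem le_total' (x y : N.HReal) : N.le x y ∨ N.le y x := by
  have wx : N.map (fun t => t.1) (N.pair x y) = x := N.map_fst_pair _ _
  have wy : N.map (fun t => t.2) (N.pair x y) = y := N.map_snd_pair _ _
  generalize N.pair x y = w at wx wy
  subst wx wy
  rw [← holds_le, ← holds_le, ← holds_or]
  exact holds_of_forall (fun _ => le_total _ _) _

theorem ofReal_le_ofReal {r s : ℝ} : N.le (N.ofReal r) (N.ofReal s) ↔ r ≤ s := by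
  let p : PUnit.{u + 1} := PUnit.unit
  have h := holds_le (N := N) (z := N.std p) (f := fun _ => ULift.up r) (g := fun _ => ULift.up s)
  rw [map_ofReal, map_ofReal] at h
  rw [← h]
  exact N.std_mem_sub {_a : PUnit.{u + 1} | r ≤ s} p

theorem add_ofReal (r s : ℝ) : N.add (N.ofReal r) (N.ofReal s) = N.ofReal (r + s) := by
  have h := map_add (N := N) (fun _ => ULift.up r) (fun _ => ULift.up s) (N.std PUnit.unit.{u + 1})
  rw [map_ofReal, map_ofReal] at h
  rw [h]
  exact map_ofReal _ _

theorem add_le_add' {a b c d : N.HReal} (hab : N.le a b) (hcd : N.le c d) :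
    N.le (N.add a c) (N.add b d) := by
  let w := N.pair (N.pair a b) (N.pair c d)
  let T := (ULift.{u} ℝ × ULift.{u} ℝ) × (ULift.{u} ℝ × ULift.{u} ℝ)
  have wa : N.map (fun t : T => t.1.1) w = a :=
    (map_comp_fst Prod.fst _ _).trans (N.map_fst_pair _ _)
  have wb : N.map (fun t : T => t.1.2) w = b :=
    (map_comp_fst Prod.snd _ _).trans (N.map_snd_pair _ _)
  have wc : N.map (fun t : T => t.2.1) w = c :=
    (map_comp_snd Prod.fst _ _).trans (N.map_fst_pair _ _)
  have wd : N.map (fun t : T => t.2.2) w = d :=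
    (map_comp_snd Prod.snd _ _).trans (N.map_snd_pair _ _)
  rw [← wa, ← wb, ← holds_le] at hab
  rw [← wc, ← wd, ← holds_le] at hcd
  rw [← wa, ← wb, ← wc, ← wd, map_add, map_add, ← holds_le]
  exact (holds_and.2 ⟨hab, hcd⟩).mono fun _ h => add_le_add h.1 h.2

theorem add_ofReal_add_ofReal (x : N.HReal) (r s : ℝ) :
    N.add (N.add x (N.ofReal r)) (N.ofReal s) = N.add x (N.ofReal (r + s)) := by
  have hx := N.map_id x
  rw [← hx, ← map_ofReal r x, ← map_ofReal s x, ← map_ofReal (r + s) x, map_add, map_add, map_add]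
  congr 1
  funext t
  exact ULift.ext _ _ (add_assoc _ _ _)

theorem add_ofReal_zero (x : N.HReal) : N.add x (N.ofReal 0) = x := by
  have hx := N.map_id x
  conv_lhs => rw [← hx, ← map_ofReal 0 x, map_add]
  conv_rhs => rw [← hx]
  congr 1
  funext t
  exact ULift.ext _ _ (add_zero _)

theorem le_refl' (x : N.HReal) : N.le x x := (le_total' x x).elim id id

theorem infClose_refl (x : N.HReal) : N.InfClose x x := by
  intro ε hε
  have h : N.le x (N.add x (N.ofReal ε)) := by
    conv_lhs => rw [← add_ofReal_zero x]
    exact add_le_add' (le_refl' x) (ofReal_le_ofReal.2 hε.le)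
  exact ⟨h, h⟩

/-- The real number `s` is infinitely close to `x`. -/
def IsSt (x : N.HReal) (s : ℝ) : Prop :=
  ∀ ε : ℝ, 0 < ε → N.le (N.ofReal (s - ε)) x ∧ N.le x (N.ofReal (s + ε))

theorem IsSt.st_eq {x : N.HReal} {s : ℝ} (h : IsSt x s) : N.st x = s := by
  have hub : ∀ r, N.le (N.ofReal r) x → r ≤ s := fun r hr =>
    le_of_forall_pos_le_add fun ε hε => ofReal_le_ofReal.1 (le_trans' hr (h ε hε).2)
  refine le_antisymm (csSup_le ⟨s - 1, (h 1 one_pos).1⟩ hub) ?_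
  refine le_of_forall_pos_sub_le fun ε hε => ?_
  exact le_csSup ⟨s, hub⟩ (h ε hε).1

/-- The real bounds make the set in the definition of `st` nonempty and bounded, so its `sSup` is
not a default value. -/
theorem isSt_st {x : N.HReal} {l b : ℝ} (hl : N.le (N.ofReal l) x) (hb : N.le x (N.ofReal b)) :
    IsSt x (N.st x) := by
  have hbdd : BddAbove {r : ℝ | N.le (N.ofReal r) x} :=
    ⟨b, fun r hr => ofReal_le_ofReal.1 (le_trans' hr hb)⟩
  intro ε hε
  constructor
  · obtain ⟨r, hr, hlt⟩ := exists_lt_of_lt_csSup ⟨l, hl⟩ (sub_lt_self (N.st x) hε)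
    exact le_trans' (ofReal_le_ofReal.2 hlt.le) hr
  · refine (le_total' _ _).resolve_left fun h => ?_
    have : N.st x + ε ≤ N.st x := le_csSup hbdd h
    linarith

theorem isSt_ofReal (r : ℝ) : IsSt (N.ofReal r) r := fun _ hε =>
  ⟨ofReal_le_ofReal.2 (sub_le_self _ hε.le), ofReal_le_ofReal.2 (le_add_of_nonneg_right hε.le)⟩

theorem IsSt.le {x y : N.HReal} {s t : ℝ} (hx : IsSt x s) (hy : IsSt y t) (h : N.le x y) :
    s ≤ t := by
  refine le_of_forall_pos_le_add fun ε hε => ?_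
  have := ofReal_le_ofReal.1
    (le_trans' (hx (ε / 2) (half_pos hε)).1 (le_trans' h (hy (ε / 2) (half_pos hε)).2))
  linarith

theorem IsSt.add {x y : N.HReal} {s t : ℝ} (hx : IsSt x s) (hy : IsSt y t) :
    IsSt (N.add x y) (s + t) := by
  intro ε hε
  have h1 := add_le_add' (hx (ε / 2) (half_pos hε)).1 (hy (ε / 2) (half_pos hε)).1
  have h2 := add_le_add' (hx (ε / 2) (half_pos hε)).2 (hy (ε / 2) (half_pos hε)).2
  rw [add_ofReal] at h1 h2
  rw [show s - ε / 2 + (t - ε / 2) = s + t - ε by ring] at h1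
  rw [show s + ε / 2 + (t + ε / 2) = s + t + ε by ring] at h2
  exact ⟨h1, h2⟩

theorem IsSt.infClose {x y : N.HReal} {s : ℝ} (hx : IsSt x s) (hy : IsSt y s) :
    N.InfClose x y := by
  have key : ∀ {x y : N.HReal}, IsSt x s → IsSt y s → ∀ ε : ℝ, 0 < ε →
      N.le x (N.add y (N.ofReal ε)) := by
    intro x y hx hy ε hε
    have h := add_le_add' (hy (ε / 2) (half_pos hε)).1 (le_refl' (N.ofReal ε))
    rw [add_ofReal, show s - ε / 2 + ε = s + ε / 2 by ring] at h
    exact le_trans' (hx (ε / 2) (half_pos hε)).2 h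
  exact fun ε hε => ⟨key hx hy ε hε, key hy hx ε hε⟩

theorem IsSt.of_infClose {x y : N.HReal} {s : ℝ} (hy : IsSt y s) (h : N.InfClose x y) :
    IsSt x s := by
  intro ε hε
  obtain ⟨h1, h2⟩ := h (ε / 2) (half_pos hε)
  obtain ⟨h3, h4⟩ := hy (ε / 2) (half_pos hε)
  constructor
  -- The `ε / 2` on the right is cancelled by adding its negative.
  · have h5 := add_le_add' (le_trans' h3 h2) (le_refl' (N.ofReal (-(ε / 2))))
    rw [add_ofReal, add_ofReal_add_ofReal, add_neg_cancel, add_ofReal_zero] at h5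
    rwa [show s - ε / 2 + -(ε / 2) = s - ε by ring] at h5
  · have h5 := add_le_add' h4 (le_refl' (N.ofReal (ε / 2)))
    rw [add_ofReal, show s + ε / 2 + ε / 2 = s + ε by ring] at h5
    exact le_trans' h1 h5

/-! ### Finitely additive real set functions -/

section Content

variable {Y : Type*} {Ω : Set Y} {F H : Set (Set Y)} {m p : Set Y → ℝ}

/-- `m` is a finitely additive probability on the algebra `F` on `Ω`. -/
structure IsContent (Ω : Set Y) (F : Set (Set Y)) (m : Set Y → ℝ) : Prop where
  algebra : IsAlgebraOn Ω F
  nonneg : ∀ A ∈ F, 0 ≤ m A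
  le_one : ∀ A ∈ F, m A ≤ 1
  additive : ∀ A ∈ F, ∀ B ∈ F, Disjoint A B → m (A ∪ B) = m A + m B

/-- The inner approximation of `B` by `m` on `F`. -/
noncomputable def inner (F : Set (Set Y)) (m : Set Y → ℝ) (B : Set Y) : ℝ :=
  sSup (m '' {A | A ∈ F ∧ A ⊆ B})

/-- The outer approximation of `B` by `m` on `F`. -/
noncomputable def outer (F : Set (Set Y)) (m : Set Y → ℝ) (B : Set Y) : ℝ :=
  sInf (m '' {C | C ∈ F ∧ B ⊆ C})

theorem IsAlgebraOn.empty_mem (h : IsAlgebraOn Ω F) : ∅ ∈ F := by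
  simpa using h.diff_mem Ω h.space_mem

theorem IsAlgebraOn.sdiff_mem (h : IsAlgebraOn Ω F) {A B : Set Y} (hA : A ∈ F) (hB : B ∈ F) :
    A \ B ∈ F := by
  have e : A \ B = Ω \ ((Ω \ A) ∪ B) := by
    ext x
    have hx : x ∈ A → x ∈ Ω := fun hx => h.subset A hA hx
    simp only [Set.mem_sdiff, Set.mem_union]
    tauto
  rw [e]
  exact h.diff_mem _ (h.union_mem _ (h.diff_mem _ hA) _ hB)

theorem IsContent.mono (h : IsContent Ω F m) {A B : Set Y} (hA : A ∈ F) (hB : B ∈ F)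
    (hAB : A ⊆ B) : m A ≤ m B := by
  have hd := h.algebra.sdiff_mem hB hA
  have := h.additive A hA (B \ A) hd Set.disjoint_sdiff_right
  rw [Set.union_sdiff_cancel hAB] at this
  linarith [h.nonneg _ hd]

theorem IsContent.union_le (h : IsContent Ω F m) {A B : Set Y} (hA : A ∈ F) (hB : B ∈ F) :
    m (A ∪ B) ≤ m A + m B := by
  have hd := h.algebra.sdiff_mem hB hA
  have := h.additive A hA (B \ A) hd Set.disjoint_sdiff_right
  rw [Set.union_sdiff_self] at this
  linarith [h.mono hd hB Set.sdiff_subset]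

theorem IsContent.le_inner (h : IsContent Ω F m) {A B : Set Y} (hA : A ∈ F) (hAB : A ⊆ B) :
    m A ≤ inner F m B :=
  le_csSup ⟨1, by rintro _ ⟨C, hC, rfl⟩; exact h.le_one C hC.1⟩ ⟨A, ⟨hA, hAB⟩, rfl⟩

theorem IsContent.outer_le (h : IsContent Ω F m) {A B : Set Y} (hA : A ∈ F) (hBA : B ⊆ A) :
    outer F m B ≤ m A :=
  csInf_le ⟨0, by rintro _ ⟨C, hC, rfl⟩; exact h.nonneg C hC.1⟩ ⟨A, ⟨hA, hBA⟩, rfl⟩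

theorem inner_le (hF : IsAlgebraOn Ω F) {B : Set Y} {r : ℝ}
    (h : ∀ A ∈ F, A ⊆ B → m A ≤ r) : inner F m B ≤ r :=
  csSup_le ⟨_, ∅, ⟨hF.empty_mem, Set.empty_subset _⟩, rfl⟩
    (by rintro _ ⟨C, hC, rfl⟩; exact h C hC.1 hC.2)

theorem le_outer (hF : IsAlgebraOn Ω F) {B : Set Y} (hB : B ⊆ Ω) {r : ℝ}
    (h : ∀ A ∈ F, B ⊆ A → r ≤ m A) : r ≤ outer F m B :=
  le_csInf ⟨_, Ω, ⟨hF.space_mem, hB⟩, rfl⟩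
    (by rintro _ ⟨C, hC, rfl⟩; exact h C hC.1 hC.2)

theorem IsContent.inner_eq (h : IsContent Ω F m) {A : Set Y} (hA : A ∈ F) :
    inner F m A = m A :=
  le_antisymm (inner_le h.algebra fun _ hC hCA => h.mono hC hA hCA)
    (h.le_inner hA Set.Subset.rfl)

theorem IsContent.outer_eq (h : IsContent Ω F m) {A : Set Y} (hA : A ∈ F) :
    outer F m A = m A :=
  le_antisymm (h.outer_le hA Set.Subset.rfl)
    (le_outer h.algebra (h.algebra.subset A hA) fun _ hC hAC => h.mono hA hC hAC)

theorem IsContent.inner_add_le (h : IsContent Ω F m) {A B : Set Y} (hAB : Disjoint A B) :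
    inner F m A + inner F m B ≤ inner F m (A ∪ B) := by
  -- The two suprema are bounded one at a time, the other being moved across the inequality.
  rw [← le_sub_iff_add_le]
  refine inner_le h.algebra fun C hC hCA => ?_
  rw [le_sub_comm]
  refine inner_le h.algebra fun D hD hDB => ?_
  rw [le_sub_iff_add_le', ← h.additive C hC D hD (hAB.mono hCA hDB)]
  exact h.le_inner (h.algebra.union_mem C hC D hD) (Set.union_subset_union hCA hDB)

theorem IsContent.outer_union_le (h : IsContent Ω F m) {A B : Set Y} (hA : A ⊆ Ω) (hB : B ⊆ Ω) :
    outer F m (A ∪ B) ≤ outer F m A + outer F m B := by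
  rw [← sub_le_iff_le_add]
  refine le_outer h.algebra hA fun C hC hAC => ?_
  rw [sub_le_comm]
  refine le_outer h.algebra hB fun D hD hBD => ?_
  rw [sub_le_iff_le_add']
  exact (h.outer_le (h.algebra.union_mem C hC D hD) (Set.union_subset_union hAC hBD)).trans
    (h.union_le hC hD)

/-- Superadditivity of `inner` and subadditivity of `outer` squeeze the value. -/
theorem IsContent.inner_union_eq (h : IsContent Ω F m) {A B : Set Y} (hA : A ⊆ Ω) (hB : B ⊆ Ω)
    (hAB : Disjoint A B) (eA : inner F m A = outer F m A) (eB : inner F m B = outer F m B)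
    (eAB : inner F m (A ∪ B) = outer F m (A ∪ B)) :
    inner F m (A ∪ B) = inner F m A + inner F m B :=
  le_antisymm (by rw [eAB, eA, eB]; exact h.outer_union_le hA hB) (h.inner_add_le hAB)

/-- A new competitor `A ∈ H` inside `B` contributes a supremum over sets of `F` inside `A`, which
already compete for `B`. -/
theorem IsContent.inner_extension (h : IsContent Ω F m) (hp : IsContent Ω H p) (hFH : F ⊆ H)
    (e : ∀ A ∈ H, p A = inner F m A) (B : Set Y) : inner H p B = inner F m B := by
  refine le_antisymm (inner_le hp.algebra fun A hA hAB => ?_)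
    (inner_le h.algebra fun C hC hCB => ?_)
  · rw [e A hA]
    exact inner_le h.algebra fun C hC hCA => h.le_inner hC (hCA.trans hAB)
  · rw [← h.inner_eq hC, ← e C (hFH hC)]
    exact hp.le_inner (hFH hC) hCB

theorem IsContent.outer_extension (h : IsContent Ω F m) (hp : IsContent Ω H p) (hFH : F ⊆ H)
    (e : ∀ A ∈ H, p A = outer F m A) {B : Set Y} (hB : B ⊆ Ω) :
    outer H p B = outer F m B := by
  refine le_antisymm (le_outer h.algebra hB fun C hC hBC => ?_)
    (le_outer hp.algebra hB fun A hA hBA => ?_)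
  · rw [← h.outer_eq hC, ← e C (hFH hC)]
    exact hp.outer_le (hFH hC) hBC
  · rw [e A hA]
    exact le_outer h.algebra (hp.algebra.subset A hA) fun C hC hAC =>
      h.outer_le hC (hBA.trans hAC)

end Content

/-! ### Internal (almost) probability spaces -/

variable {Ω : Set (N.Star X)} {F H : Set (Set (N.Star X))} {μ P : Set (N.Star X) → N.HReal}

theorem IsInternalProbabilitySpace.almost (h : N.IsInternalProbabilitySpace Ω F μ) :
    N.IsInternalAlmostProbabilitySpace Ω F μ :=
  ⟨h.algebra, h.internal, h.mem_unitInterval, h.empty, h.space, fun A hA B hB hAB => by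
    rw [h.additive A hA B hB hAB]; exact infClose_refl _⟩

theorem IsInternalAlmostProbabilitySpace.isSt (h : N.IsInternalAlmostProbabilitySpace Ω F P)
    {A : Set (N.Star X)} (hA : A ∈ F) : IsSt (P A) (N.st (P A)) :=
  isSt_st (h.mem_unitInterval A hA).1 (h.mem_unitInterval A hA).2

/-- Standard parts turn almost additivity into exact additivity, so the results on real contents
apply; `inner` and `outer` then unfold to `innerLoeb` and `outerLoeb`. -/
theorem IsInternalAlmostProbabilitySpace.isContent
    (h : N.IsInternalAlmostProbabilitySpace Ω F P) :
    IsContent Ω F (fun A => N.st (P A)) where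
  algebra := h.algebra.isAlgebraOn
  nonneg A hA := (isSt_ofReal 0).le (h.isSt hA) (h.mem_unitInterval A hA).1
  le_one A hA := (h.isSt hA).le (isSt_ofReal 1) (h.mem_unitInterval A hA).2
  additive A hA B hB hAB :=
    (((h.isSt hA).add (h.isSt hB)).of_infClose (h.almost_additive A hA B hB hAB)).st_eq

theorem IsInternalAlmostProbabilitySpace.subset_loebSets
    (h : N.IsInternalAlmostProbabilitySpace Ω H P) : H ⊆ N.loebSets Ω H P := fun A hA =>
  ⟨h.algebra.subset A hA, (h.isContent.inner_eq hA).trans (h.isContent.outer_eq hA).symm⟩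

/-- The internal inner set function `A ↦ sup {f C : C ∈ φ, C ⊆ A}`. -/
theorem exists_internal_inner (f : N.Star (Set X → ULift.{u} ℝ)) (φ : N.Star (Set (Set X)))
    (hf : ∀ c ∈ N.toSet φ, N.le (N.app f c) (N.ofReal 1)) :
    ∃ g : N.Star (Set X → ULift.{u} ℝ), ∀ a : N.Star (Set X),
      (∀ c ∈ N.toSet φ, N.toSet c ⊆ N.toSet a → N.le (N.app f c) (N.app g a)) ∧
      ∀ x : N.HReal, (∃ c ∈ N.toSet φ, N.toSet c ⊆ N.toSet a) →
        (∀ c ∈ N.toSet φ, N.toSet c ⊆ N.toSet a → N.le (N.app f c) x) →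
          N.le (N.app g a) x := by
  let W := (Set X → ULift.{u} ℝ) × Set (Set X)
  let s : W → Set X → Set ℝ := fun w A => (fun C => (w.1 C).down) '' {C | C ∈ w.2 ∧ C ⊆ A}
  -- The real `sSup` is meaningful only for nonempty bounded sets: `hbd` supplies the bound for the
  -- first claim, and the second assumes a competitor `c`.
  let q : W → Set X → ULift.{u} ℝ := fun w A => ULift.up (sSup (s w A))
  let z : N.Star W := N.pair f φ
  have zf : N.map (fun w : W => w.1) z = f := N.map_fst_pair _ _
  have zφ : N.map (fun w : W => w.2) z = φ := N.map_snd_pair _ _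
  have hbd : N.Holds z (fun w => ∀ C, C ∈ w.2 → (w.1 C).down ≤ (ULift.up.{u} (1 : ℝ)).down) := by
    rw [holds_forall]
    intro c
    rw [holds_imp, holds_mem, holds_le, ← map_app (fun t : W × Set X => t.1.1) (fun t => t.2),
      map_comp_fst (fun w : W => w.1), map_comp_fst (fun w : W => w.2), N.map_snd_pair z c, zf, zφ,
      map_ofReal]
    exact hf c
  refine ⟨N.map q z, fun a => ⟨fun c hc hca => ?_, fun x hne hx => ?_⟩⟩
  · let T := (W × Set X) × Set X
    let y : N.Star T := N.pair (N.pair z a) c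
    have yz : ∀ {δ : Type u} (k : W → δ), N.map (fun t : T => k t.1.1) y = N.map k z := fun k =>
      (map_comp_fst (fun t : W × Set X => k t.1) _ _).trans (map_comp_fst k _ _)
    have ya : N.map (fun t : T => t.1.2) y = a :=
      (map_comp_fst Prod.snd _ _).trans (N.map_snd_pair _ _)
    have yc : N.map (fun t : T => t.2) y = c := N.map_snd_pair _ _
    have yf := (yz fun w => w.1).trans zf
    have yφ := (yz fun w => w.2).trans zφ
    have yq := yz q
    have hb : N.Holds y (fun t => ∀ C, C ∈ t.1.1.2 → (t.1.1.1 C).down ≤ (1 : ℝ)) := by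
      have hz : N.map (fun t : T => t.1.1) y = z := (yz id).trans (N.map_id z)
      rw [← hz, holds_map] at hbd
      exact hbd
    rw [← yφ, ← yc, ← holds_mem] at hc
    rw [← ya, ← yc, map_subset_iff] at hca
    rw [← yf, ← yq, ← ya, ← yc, map_app, map_app, ← holds_le]
    refine (holds_and.2 ⟨hb, holds_and.2 ⟨hc, hca⟩⟩).mono fun t ht => ?_
    exact le_csSup ⟨1, by rintro _ ⟨C, hC, rfl⟩; exact ht.1 C hC.1⟩ ⟨_, ht.2, rfl⟩
  · let T := (W × Set X) × ULift.{u} ℝ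
    let y : N.Star T := N.pair (N.pair z a) x
    have yz : ∀ {δ : Type u} (k : W → δ), N.map (fun t : T => k t.1.1) y = N.map k z := fun k =>
      (map_comp_fst (fun t : W × Set X => k t.1) _ _).trans (map_comp_fst k _ _)
    have ya : N.map (fun t : T => t.1.2) y = a :=
      (map_comp_fst Prod.snd _ _).trans (N.map_snd_pair _ _)
    have yx : N.map (fun t : T => t.2) y = x := N.map_snd_pair _ _
    have yf := (yz fun w => w.1).trans zf
    have yφ := (yz fun w => w.2).trans zφ
    have yq := yz q
    have h1 : N.Holds y (fun t => ∃ C, C ∈ t.1.1.2 ∧ C ⊆ t.1.2) := by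
      obtain ⟨c, hc, hca⟩ := hne
      rw [holds_exists]
      refine ⟨c, ?_⟩
      rw [holds_and, holds_mem, ← map_subset_iff, map_comp_fst (fun t : T => t.1.1.2),
        map_comp_fst (fun t : T => t.1.2), N.map_snd_pair, yφ, ya]
      exact ⟨hc, hca⟩
    have h2 : N.Holds y (fun t => ∀ C, C ∈ t.1.1.2 → C ⊆ t.1.2 →
        (t.1.1.1 C).down ≤ t.2.down) := by
      rw [holds_forall]
      intro c
      rw [holds_imp, holds_imp, holds_mem, ← map_subset_iff, holds_le,
        ← map_app (fun t : T × Set X => t.1.1.1.1) (fun t => t.2),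
        map_comp_fst (fun t : T => t.1.1.1), map_comp_fst (fun t : T => t.1.1.2),
        map_comp_fst (fun t : T => t.1.2), map_comp_fst (fun t : T => t.2), N.map_snd_pair,
        yf, yφ, ya, yx]
      exact hx c
    rw [← yq, ← ya, map_app]
    conv_rhs => rw [← yx]
    rw [← holds_le]
    refine (holds_and.2 ⟨h1, h2⟩).mono fun t ht => ?_
    obtain ⟨⟨C, hC⟩, h⟩ := ht
    exact csSup_le ⟨_, C, hC, rfl⟩ (by rintro _ ⟨D, hD, rfl⟩; exact h D hD.1 hD.2)

/-- There is an internal map `P` on the internal sets whose standard part is the inner Loeb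
approximation. -/
theorem IsInternalProbabilitySpace.exists_internal_inner
    (h : N.IsInternalProbabilitySpace Ω F μ) :
    ∃ P : Set (N.Star X) → N.HReal, (∃ g, ∀ a, P (N.toSet a) = N.app g a) ∧
      P ∅ = N.ofReal 0 ∧ P Ω = N.ofReal 1 ∧
      ∀ a, N.le (N.ofReal 0) (P (N.toSet a)) ∧ N.le (P (N.toSet a)) (N.ofReal 1) ∧
        IsSt (P (N.toSet a)) (N.innerLoeb F μ (N.toSet a)) := by
  classical
  obtain ⟨φ, hφ⟩ := h.algebra.internal
  obtain ⟨f, hf⟩ := h.internal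
  have hc := h.almost.isContent
  have hmem : ∀ c, c ∈ N.toSet φ ↔ N.toSet c ∈ F := fun c => by rw [hφ, toSet_mem_image]
  obtain ⟨ω, hω, rfl⟩ : Ω ∈ N.toSet '' N.toSet φ := hφ ▸ h.algebra.space_mem
  obtain ⟨o, ho, ho'⟩ : ∅ ∈ N.toSet '' N.toSet φ := hφ ▸ hc.algebra.empty_mem
  have hμ : ∀ c ∈ N.toSet φ, N.app f c = μ (N.toSet c) := fun c hcφ =>
    (hf c ((hmem c).1 hcφ)).symm
  obtain ⟨g, hg⟩ := StarExtension.exists_internal_inner f φ fun c hcφ => by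
    rw [hμ c hcφ]; exact (h.mem_unitInterval _ ((hmem c).1 hcφ)).2
  have hne : ∀ a : N.Star (Set X), ∃ c ∈ N.toSet φ, N.toSet c ⊆ N.toSet a := fun a =>
    ⟨o, ho, ho' ▸ Set.empty_subset _⟩
  have h0 : ∀ a, N.le (N.ofReal 0) (N.app g a) := fun a => by
    rw [← h.empty, ← ho', ← hμ o ho]
    exact (hg a).1 o ho (ho' ▸ Set.empty_subset _)
  have h1 : ∀ a, N.le (N.app g a) (N.ofReal 1) := fun a =>
    (hg a).2 _ (hne a) fun c hcφ _ => by
      rw [hμ c hcφ]; exact (h.mem_unitInterval _ ((hmem c).1 hcφ)).2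
  -- `g` acts on codes and `P` on sets; codes are unique by `toSet_injective`, and the value at
  -- external sets is arbitrary.
  let P : Set (N.Star X) → N.HReal := fun A =>
    if hA : ∃ a, N.toSet a = A then N.app g hA.choose else N.ofReal 0
  have hP : ∀ a, P (N.toSet a) = N.app g a := fun a => by
    have hA : ∃ b, N.toSet b = N.toSet a := ⟨a, rfl⟩
    simp only [P, dif_pos hA, toSet_injective hA.choose_spec]
  refine ⟨P, ⟨g, hP⟩, ?_, ?_, fun a => ?_⟩
  · rw [← ho', hP]
    refine le_antisymm' ((hg o).2 _ (hne o) fun c hcφ hco => ?_) (h0 o)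
    rw [ho', Set.subset_empty_iff] at hco
    rw [hμ c hcφ, hco, h.empty]
    exact le_refl' _
  · rw [hP]
    refine le_antisymm' (h1 ω) ?_
    rw [← h.space, ← hμ ω hω]
    exact (hg ω).1 ω hω Set.Subset.rfl
  · rw [hP]
    refine ⟨h0 a, h1 a, fun ε hε => ⟨?_, ?_⟩⟩
    -- Otherwise every `st (μ C)` with `C ∈ F` inside the set would be at most the inner
    -- approximation minus `ε`, and so would their supremum.
    · refine (le_total' _ _).resolve_right fun hle => ?_
      have : N.innerLoeb F μ (N.toSet a) ≤ N.innerLoeb F μ (N.toSet a) - ε := by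
        refine inner_le hc.algebra fun C hC hCa => ?_
        obtain ⟨c, hcφ, rfl⟩ : C ∈ N.toSet '' N.toSet φ := hφ ▸ hC
        refine (h.almost.isSt hC).le (isSt_ofReal _) (le_trans' ?_ hle)
        rw [← hμ c hcφ]
        exact (hg a).1 c hcφ hCa
      linarith
    -- Each `μ C` is below its standard part plus `ε`; this one bound serves all `C`, so the least
    -- upper bound obeys it.
    · refine (hg a).2 _ (hne a) fun c hcφ hca => ?_
      rw [hμ c hcφ]
      refine le_trans' ((h.almost.isSt ((hmem c).1 hcφ)) ε hε).2 (ofReal_le_ofReal.2 ?_)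
      have : N.st (μ (N.toSet c)) ≤ N.innerLoeb F μ (N.toSet a) :=
        hc.le_inner ((hmem c).1 hcφ) hca
      linarith

/-- `H` may be any internal algebra between `F` and `L(F)`; that it is generated plays no role here.
-/
theorem IsInternalProbabilitySpace.exists_loebEquivalent
    (h : N.IsInternalProbabilitySpace Ω F μ) (hH : N.IsInternalAlgebra Ω H) (hFH : F ⊆ H)
    (hL : H ⊆ N.loebSets Ω F μ) :
    ∃ P, N.IsInternalAlmostProbabilitySpace Ω H P ∧ N.LoebEquivalent Ω H P F μ := by
  obtain ⟨P, ⟨g, hg⟩, h0, h1, hP⟩ := h.exists_internal_inner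
  have hc := h.almost.isContent
  have hHint : ∀ A ∈ H, ∃ a, N.toSet a = A := by
    obtain ⟨k, hk⟩ := hH.internal
    intro A hA
    rw [hk] at hA
    exact ⟨_, hA.choose_spec.2⟩
  have hst : ∀ A ∈ H, IsSt (P A) (N.innerLoeb F μ A) := fun A hA => by
    obtain ⟨a, rfl⟩ := hHint A hA
    exact (hP a).2.2
  have hPs : N.IsInternalAlmostProbabilitySpace Ω H P := by
    refine ⟨hH, ⟨g, fun a _ => hg a⟩, fun A hA => ?_, h0, h1, fun A hA B hB hAB => ?_⟩
    · obtain ⟨a, rfl⟩ := hHint A hA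
      exact ⟨(hP a).1, (hP a).2.1⟩
    · have hU := hH.union_mem A hA B hB
      -- The union must be in `L(F)` too, which holds because `H` is closed under unions.
      have hadd : N.innerLoeb F μ (A ∪ B) = N.innerLoeb F μ A + N.innerLoeb F μ B :=
        hc.inner_union_eq (hL hA).1 (hL hB).1 hAB (hL hA).2 (hL hB).2 (hL hU).2
      have := hst _ hU
      rw [hadd] at this
      exact this.infClose ((hst A hA).add (hst B hB))
  have hin : ∀ B, N.innerLoeb H P B = N.innerLoeb F μ B :=
    hc.inner_extension hPs.isContent hFH fun A hA => (hst A hA).st_eq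
  -- `P` was built from inner approximations; `hL` makes its standard part the outer approximation
  -- as well.
  have hout : ∀ B, B ⊆ Ω → N.outerLoeb H P B = N.outerLoeb F μ B := fun B hB =>
    hc.outer_extension hPs.isContent hFH (fun A hA => (hst A hA).st_eq.trans (hL hA).2) hB
  refine ⟨P, hPs, ?_, fun B _ => hin B⟩
  ext B
  refine and_congr_right fun hB => ?_
  rw [hin, hout B hB]

end StarExtension

theorem theorem3p5 (N : NonstandardUniverse.{u, v}) {X : Type u}
    (Ω : Set (N.Star X)) (F G : Set (Set (N.Star X))) (μ : Set (N.Star X) → N.HReal)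
    (hμ : N.IsInternalProbabilitySpace Ω F μ) (hG : N.IsInternalAlgebra Ω G) :
    (∃ P : Set (N.Star X) → N.HReal,
        N.IsInternalAlmostProbabilitySpace Ω (N.internalAlgebraGen Ω (F ∪ G)) P ∧
          N.LoebEquivalent Ω (N.internalAlgebraGen Ω (F ∪ G)) P F μ) ↔
      N.internalAlgebraGen Ω (F ∪ G) ⊆ N.loebSets Ω F μ := by
  constructor
  · rintro ⟨P, hP, hE⟩
    rw [hE.1]
    exact hP.subset_loebSets
  · exact hμ.exists_loebEquivalent (StarExtension.isInternalAlgebra_gen hμ.algebra hG)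
      (Set.subset_union_left.trans (StarExtension.subset_internalAlgebraGen Ω (F ∪ G)))
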